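/- Let $\lVert\cdot\rVert$ denote the Frobenius norm, and let $A\in\mathbb{R}^{m\times p}$, $B\in\mathbb{R}^{m\times n}$, $C\in\mathbb{R}^{n\times p}$. Put $k=\operatorname{rank}\begin{bmatrix}B\\ C^{\mathsf T}\end{bmatrix}$. A generalized singular value decomposition (GSVD) of $(B,C^{\mathsf T})$ consists of integers $r,s\ge 0$ with $r+s\le k$, orthogonal matrices $U\in\mathbb{R}^{m\times m}$, $V\in\mathbb{R}^{p\times p}$, $W\in\mathbb{R}^{k\times k}$, $Q\in\mathbb{R}^{n\times n}$ and a nonsingular $R\in\mathbb{R}^{k\times k}$, whose singular values are the nonzero singular values of $\begin{bmatrix}B\\ C^{\mathsf T}\end{bmatrix}$, such that $$U^{\mathsf T}BQ=\Sigma_B\begin{bmatrix}W^{\mathsf T}R&0\end{bmatrix},\qquad V^{\mathsf T}C^{\mathsf T}Q=\Sigma_C\begin{bmatrix}W^{\mathsf T}R&0\end{bmatrix},$$ where $\Sigma_B=\operatorname{diag}(I_B,S_B,O_B)\in\mathbb{R}^{m\times k}$ and $\Sigma_C=\operatorname{diag}(O_C,S_C,I_C)\in\mathbb{R}^{p\times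 k}$ are block diagonal, $I_B$ and $I_C$ are the identity matrices of sizes $r$ and $k-r-s$, $O_B\in\mathbb{R}^{(m-r-s)\times(k-r-s)}$ and $O_C\in\mathbb{R}^{(p-k+r)\times r}$ are zero (any of these blocks may be empty), $S_B=\operatorname{diag}(\beta_{r+1},\dots,\beta_{r+s})$ and $S_C=\operatorname{diag}(\gamma_{r+1},\dots,\gamma_{r+s})$ with $$1>\beta_{r+1}\ge\dots\ge\beta_{r+s}>0,\qquad 0<\gamma_{r+1}\le\dots\le\gamma_{r+s}<1.$$ A GSVD of $(B,C^{\mathsf T})$ exists. Moreover, given any GSVD of $(B,C^{\mathsf T})$, let $$M=Q\begin{bmatrix}R^{-1}W&0\\0&I\end{bmatrix},\qquad U^{\mathsf T}AV=\begin{bmatrix}A_{11}&A_{12}&A_{13}\\A_{21}&A_{22}&A_{23}\\A_{31}&A_{32}&A_{33}\end{bmatrix},$$ the rows being partitioned into $r,\ s,\ m-r-s$ and the columns into $p-k+r,\ s,\ k-r-s$; write $A_{22}=(a_{ij})_{i,j=1}^s$ and $\sigma_{ij}=\beta_{r+i}\gamma_{r+j}$. (a) (Symmetric case.) Let $X_{22}=(x_{ij})\in\mathbb{R}^{s\times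 s}$ with $$x_{ij}=x_{ji}=\frac{a_{ij}\sigma_{ij}+a_{ji}\sigma_{ji}}{\sigma_{ij}^2+\sigma_{ji}^2}\ \text{ if }\sigma_{ij}^2+\sigma_{ji}^2\ne0,\qquad x_{ij}=0\ \text{ otherwise}.$$ Then $$\widehat X=M\begin{bmatrix}0&A_{12}S_C^{-1}&A_{13}&0\\ S_C^{-\mathsf T}A_{12}^{\mathsf T}&X_{22}&S_B^{-1}A_{23}&0\\ A_{13}^{\mathsf T}&A_{23}^{\mathsf T}S_B^{-\mathsf T}&0&0\\0&0&0&0\end{bmatrix}M^{\mathsf T}$$ is symmetric and is a global minimizer of $\lVert A-BXC\rVert$ over all symmetric $X\in\mathbb{R}^{n\times n}$. (b) (Skew-symmetric case.) Let $X_{22}=(x_{ij})\in\mathbb{R}^{s\times s}$ with $$x_{ij}=-x_{ji}=\frac{a_{ij}\sigma_{ij}-a_{ji}\sigma_{ji}}{\sigma_{ij}^2+\sigma_{ji}^2}\ \text{ if }\sigma_{ij}^2+\sigma_{ji}^2\ne0,\qquad x_{ij}=0\ \text{ otherwise}.$$ Then $$\widehat X=M\begin{bmatrix}0&A_{12}S_C^{-1}&A_{13}&0\\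 -S_C^{-\mathsf T}A_{12}^{\mathsf T}&X_{22}&S_B^{-1}A_{23}&0\\ -A_{13}^{\mathsf T}&-A_{23}^{\mathsf T}S_B^{-\mathsf T}&0&0\\0&0&0&0\end{bmatrix}M^{\mathsf T}$$ is skew-symmetric and is a global minimizer of $\lVert A-BXC\rVert$ over all skew-symmetric $X\in\mathbb{R}^{n\times n}$. -/

import Mathlib

open Matrix

attribute [local instance] Matrix.frobeniusNormedAddCommGroup

noncomputable section

/-- The singular values of a real matrix, in decreasing order with multiplicity, followed by
zeros. -/
def matSingularValues {a b : Type} [Fintype a] [Fintype b] [DecidableEq b]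
    (N : Matrix a b ℝ) : ℕ →₀ ℝ :=
  (Matrix.toEuclideanLin N).singularValues

/-- The order-preserving identification of three consecutive blocks of lengths `a`, `b`, `c` with
`{0, …, N - 1}`, where `a + b + c = N`. -/
def blocks3 {a b c N : ℕ} (h : a + (b + c) = N) : Fin a ⊕ (Fin b ⊕ Fin c) ≃ Fin N :=
  ((Equiv.sumCongr (Equiv.refl (Fin a)) finSumFinEquiv).trans finSumFinEquiv).trans (finCongr h)

/-- The order-preserving identification of four consecutive blocks of lengths `a`, `b`, `c`, `d`
with `{0, …, N - 1}`, grouped as (the first three) and (the last one). -/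
def blocks4 {a b c d N : ℕ} (h : a + (b + c) + d = N) :
    (Fin a ⊕ (Fin b ⊕ Fin c)) ⊕ Fin d ≃ Fin N :=
  ((Equiv.sumCongr (blocks3 rfl) (Equiv.refl (Fin d))).trans finSumFinEquiv).trans (finCongr h)

/-- `Σ_B = diag(I_B, S_B, O_B)` with `I_B` the `r × r` identity, `S_B = diag(β)` and `O_B` the
`u × t` zero matrix. -/
def sigmaB (r t u : ℕ) {s : ℕ} (β : Fin s → ℝ) :
    Matrix (Fin r ⊕ (Fin s ⊕ Fin u)) (Fin r ⊕ (Fin s ⊕ Fin t)) ℝ :=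
  fromBlocks 1 0 0 (fromBlocks (diagonal β) 0 0 0)

/-- `Σ_C = diag(O_C, S_C, I_C)` with `O_C` the `v × r` zero matrix, `S_C = diag(γ)` and `I_C` the
`t × t` identity. -/
def sigmaC (r t v : ℕ) {s : ℕ} (γ : Fin s → ℝ) :
    Matrix (Fin v ⊕ (Fin s ⊕ Fin t)) (Fin r ⊕ (Fin s ⊕ Fin t)) ℝ :=
  fromBlocks 0 0 0 (fromBlocks (diagonal γ) 0 0 1)

/-- A generalized singular value decomposition of the pair `(B, Cᵀ)`.  With `k` the rank of the
stacked matrix, the block sizes are `t = k - r - s`, `u = m - r - s`, `v = p - k + r` and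
`d = n - k`. -/
structure GSVD {m n p : ℕ} (B : Matrix (Fin m) (Fin n) ℝ) (C : Matrix (Fin n) (Fin p) ℝ) where
  (r s t u v d : ℕ)
  rank_eq : r + (s + t) = (fromRows B Cᵀ).rank
  m_eq : r + (s + u) = m
  p_eq : v + (s + t) = p
  n_eq : r + (s + t) + d = n
  U : Matrix (Fin m) (Fin m) ℝ
  V : Matrix (Fin p) (Fin p) ℝ
  W : Matrix (Fin r ⊕ (Fin s ⊕ Fin t)) (Fin r ⊕ (Fin s ⊕ Fin t)) ℝ
  Q : Matrix (Fin n) (Fin n) ℝ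
  R : Matrix (Fin r ⊕ (Fin s ⊕ Fin t)) (Fin r ⊕ (Fin s ⊕ Fin t)) ℝ
  β : Fin s → ℝ
  γ : Fin s → ℝ
  U_orth : U ∈ orthogonalGroup (Fin m) ℝ
  V_orth : V ∈ orthogonalGroup (Fin p) ℝ
  W_orth : W ∈ orthogonalGroup (Fin r ⊕ (Fin s ⊕ Fin t)) ℝ
  Q_orth : Q ∈ orthogonalGroup (Fin n) ℝ
  R_nonsingular : IsUnit R.det
  R_singularValues : matSingularValues R = matSingularValues (fromRows B Cᵀ)
  β_antitone : Antitone β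
  γ_monotone : Monotone γ
  β_mem : ∀ i, 0 < β i ∧ β i < 1
  γ_mem : ∀ i, 0 < γ i ∧ γ i < 1
  B_eq : (Uᵀ * B * Q).submatrix (blocks3 m_eq) (blocks4 n_eq) =
    sigmaB r t u β * fromCols (Wᵀ * R) 0
  C_eq : (Vᵀ * Cᵀ * Q).submatrix (blocks3 p_eq) (blocks4 n_eq) =
    sigmaC r t v γ * fromCols (Wᵀ * R) 0

namespace GSVD

variable {m n p : ℕ} {B : Matrix (Fin m) (Fin n) ℝ} {C : Matrix (Fin n) (Fin p) ℝ}

/-- `M = Q * diag(R⁻¹ W, I)`. -/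
def M (G : GSVD B C) :
    Matrix (Fin n) ((Fin G.r ⊕ (Fin G.s ⊕ Fin G.t)) ⊕ Fin G.d) ℝ :=
  G.Q.submatrix id (blocks4 G.n_eq) *
    (fromBlocks (G.R⁻¹ * G.W) 0 0 1 :
      Matrix ((Fin G.r ⊕ (Fin G.s ⊕ Fin G.t)) ⊕ Fin G.d)
        ((Fin G.r ⊕ (Fin G.s ⊕ Fin G.t)) ⊕ Fin G.d) ℝ)

/-- `Uᵀ A V`, partitioned into `3 × 3` blocks `A₁₁, …, A₃₃`: the rows into `r`, `s`, `u`, the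
columns into `v`, `s`, `t`. -/
def tildeA (G : GSVD B C) (A : Matrix (Fin m) (Fin p) ℝ) :
    Matrix (Fin G.r ⊕ (Fin G.s ⊕ Fin G.u)) (Fin G.v ⊕ (Fin G.s ⊕ Fin G.t)) ℝ :=
  (G.Uᵀ * A * G.V).submatrix (blocks3 G.m_eq) (blocks3 G.p_eq)

def A₁₂ (G : GSVD B C) (A : Matrix (Fin m) (Fin p) ℝ) : Matrix (Fin G.r) (Fin G.s) ℝ :=
  (G.tildeA A).toBlocks₁₂.toCols₁

def A₁₃ (G : GSVD B C) (A : Matrix (Fin m) (Fin p) ℝ) : Matrix (Fin G.r) (Fin G.t) ℝ :=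
  (G.tildeA A).toBlocks₁₂.toCols₂

def A₂₂ (G : GSVD B C) (A : Matrix (Fin m) (Fin p) ℝ) : Matrix (Fin G.s) (Fin G.s) ℝ :=
  (G.tildeA A).toBlocks₂₂.toBlocks₁₁

def A₂₃ (G : GSVD B C) (A : Matrix (Fin m) (Fin p) ℝ) : Matrix (Fin G.s) (Fin G.t) ℝ :=
  (G.tildeA A).toBlocks₂₂.toBlocks₁₂

def SB (G : GSVD B C) : Matrix (Fin G.s) (Fin G.s) ℝ := diagonal G.β

def SC (G : GSVD B C) : Matrix (Fin G.s) (Fin G.s) ℝ := diagonal G.γ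

def σ (G : GSVD B C) (i j : Fin G.s) : ℝ := G.β i * G.γ j

open Classical in
/-- The middle block in the symmetric case. -/
def symmX₂₂ (G : GSVD B C) (A : Matrix (Fin m) (Fin p) ℝ) : Matrix (Fin G.s) (Fin G.s) ℝ :=
  Matrix.of fun i j =>
    if G.σ i j ^ 2 + G.σ j i ^ 2 ≠ 0 then
      (G.A₂₂ A i j * G.σ i j + G.A₂₂ A j i * G.σ j i) / (G.σ i j ^ 2 + G.σ j i ^ 2)
    else 0

open Classical in
/-- The middle block in the skew-symmetric case. -/
def skewX₂₂ (G : GSVD B C) (A : Matrix (Fin m) (Fin p) ℝ) : Matrix (Fin G.s) (Fin G.s) ℝ :=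
  Matrix.of fun i j =>
    if G.σ i j ^ 2 + G.σ j i ^ 2 ≠ 0 then
      (G.A₂₂ A i j * G.σ i j - G.A₂₂ A j i * G.σ j i) / (G.σ i j ^ 2 + G.σ j i ^ 2)
    else 0

/-- The `4 × 4` block matrix of the symmetric case; the fourth block row and column vanish. -/
def symmBlocks (G : GSVD B C) (A : Matrix (Fin m) (Fin p) ℝ) :
    Matrix ((Fin G.r ⊕ (Fin G.s ⊕ Fin G.t)) ⊕ Fin G.d)
      ((Fin G.r ⊕ (Fin G.s ⊕ Fin G.t)) ⊕ Fin G.d) ℝ :=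
  fromBlocks
    (fromBlocks
      0 (fromCols (G.A₁₂ A * G.SC⁻¹) (G.A₁₃ A))
      (fromRows ((G.SC⁻¹)ᵀ * (G.A₁₂ A)ᵀ) (G.A₁₃ A)ᵀ)
      (fromBlocks
        (G.symmX₂₂ A) (G.SB⁻¹ * G.A₂₃ A)
        ((G.A₂₃ A)ᵀ * (G.SB⁻¹)ᵀ) 0))
    0 0 0

/-- The `4 × 4` block matrix of the skew-symmetric case. -/
def skewBlocks (G : GSVD B C) (A : Matrix (Fin m) (Fin p) ℝ) :
    Matrix ((Fin G.r ⊕ (Fin G.s ⊕ Fin G.t)) ⊕ Fin G.d)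
      ((Fin G.r ⊕ (Fin G.s ⊕ Fin G.t)) ⊕ Fin G.d) ℝ :=
  fromBlocks
    (fromBlocks
      0 (fromCols (G.A₁₂ A * G.SC⁻¹) (G.A₁₃ A))
      (fromRows (-((G.SC⁻¹)ᵀ * (G.A₁₂ A)ᵀ)) (-(G.A₁₃ A)ᵀ))
      (fromBlocks
        (G.skewX₂₂ A) (G.SB⁻¹ * G.A₂₃ A)
        (-((G.A₂₃ A)ᵀ * (G.SB⁻¹)ᵀ)) 0))
    0 0 0

/-- The symmetric output `M * (block matrix) * Mᵀ`. -/
def symmSol (G : GSVD B C) (A : Matrix (Fin m) (Fin p) ℝ) : Matrix (Fin n) (Fin n) ℝ :=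
  G.M * G.symmBlocks A * G.Mᵀ

/-- The skew-symmetric output `M * (block matrix) * Mᵀ`. -/
def skewSol (G : GSVD B C) (A : Matrix (Fin m) (Fin p) ℝ) : Matrix (Fin n) (Fin n) ℝ :=
  G.M * G.skewBlocks A * G.Mᵀ

end GSVD

end

/-! Optimality. `G.M` is invertible, with Uᵀ B M = Σ_B [I 0] and Vᵀ Cᵀ M = Σ_C [I 0]. Substituting X
= M Y Mᵀ preserves symmetry and skew-symmetry, and orthogonal invariance of the norm turns the
residual into Uᵀ A V - Σ_B Y₁₁ Σ_Cᵀ, where Y₁₁ is the leading k × k block. The zero blocks of Σ_B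
and Σ_C leave five of the nine blocks out of reach. Three others meet blocks of Y strictly above the
diagonal, which are free and can be fitted exactly. Only the middle block is constrained: its
entries at (i, j) and (j, i) are tied by a sign, so it splits into one-variable least-squares
problems (`pair_sq_le`). `norm_residual_le` treats both signs at once.

Existence. Let K be B stacked on Cᵀ. Diagonalising Kᵀ K gives Q, and scaling the k nonzero columns
of K Q to unit length gives P₁ stacked on P₂ with orthonormal columns. Since P₂ᵀ P₂ = I - P₁ᵀ P₁, an
eigenbasis W of P₁ᵀ P₁ makes the columns of both P₁ W and P₂ W orthogonal; the nonzero ones,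
normalised, extend to U and V (`exists_cs_decomposition`). R is the diagonal matrix of nonzero
singular values of K. -/

/-! ### Orthogonal invariance of the Frobenius norm. -/

/-- The sum of the squares of the entries. -/
def sumSq {a b : Type*} [Fintype a] [Fintype b] (A : Matrix a b ℝ) : ℝ := ∑ i, ∑ j, A i j ^ 2

lemma frobenius_norm_le_iff {a b c d : Type*} [Fintype a] [Fintype b] [Fintype c] [Fintype d]
    (A : Matrix a b ℝ) (B : Matrix c d ℝ) : ‖A‖ ≤ ‖B‖ ↔ sumSq A ≤ sumSq B := by
  rw [frobenius_norm_def, frobenius_norm_def, ← Real.sqrt_eq_rpow, ← Real.sqrt_eq_rpow,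
    Real.sqrt_le_sqrt_iff (by positivity)]
  simp [sumSq]

lemma sumSq_eq_trace {a b : Type*} [Fintype a] [Fintype b] (A : Matrix a b ℝ) :
    sumSq A = (A * Aᵀ : Matrix a a ℝ).trace := by
  simp [trace, mul_apply, sq, sumSq]

lemma mul_transpose_of_mem_orthogonalGroup {a : Type*} [Fintype a] [DecidableEq a]
    {U : Matrix a a ℝ} (hU : U ∈ orthogonalGroup a ℝ) : U * Uᵀ = 1 := by
  simpa [star_eq_conjTranspose] using (mem_orthogonalGroup_iff _ _).1 hU

lemma transpose_mul_of_mem_orthogonalGroup {a : Type*} [Fintype a] [DecidableEq a]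
    {U : Matrix a a ℝ} (hU : U ∈ orthogonalGroup a ℝ) : Uᵀ * U = 1 := by
  simpa [star_eq_conjTranspose] using (mem_orthogonalGroup_iff' _ _).1 hU

lemma sumSq_orthogonal {a b : Type*} [Fintype a] [Fintype b] [DecidableEq a] [DecidableEq b]
    {U : Matrix a a ℝ} {V : Matrix b b ℝ} (hU : U ∈ orthogonalGroup a ℝ)
    (hV : V ∈ orthogonalGroup b ℝ) (A : Matrix a b ℝ) : sumSq (Uᵀ * A * V) = sumSq A := by
  replace hU := mul_transpose_of_mem_orthogonalGroup hU
  replace hV := mul_transpose_of_mem_orthogonalGroup hV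
  rw [sumSq_eq_trace, sumSq_eq_trace]
  have : Uᵀ * A * V * (Uᵀ * A * V)ᵀ = Uᵀ * (A * Aᵀ * U) := by
    simp only [transpose_mul, transpose_transpose, Matrix.mul_assoc]
    rw [← Matrix.mul_assoc V, hV, Matrix.one_mul]
  rw [this, trace_mul_comm, Matrix.mul_assoc, hU, Matrix.mul_one]

lemma sumSq_submatrix {a b c d : Type*} [Fintype a] [Fintype b] [Fintype c] [Fintype d]
    (A : Matrix a b ℝ) (e : c ≃ a) (f : d ≃ b) : sumSq (A.submatrix e f) = sumSq A := by
  simp only [sumSq, submatrix_apply]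
  rw [e.sum_comp (fun i => ∑ j, A i (f j) ^ 2)]
  exact Finset.sum_congr rfl fun i _ => f.sum_comp (fun j => A i j ^ 2)

/-! ### Reduction to canonical form and blockwise minimisation. -/

namespace GSVD

variable {m n p : ℕ} {B : Matrix (Fin m) (Fin n) ℝ} {C : Matrix (Fin n) (Fin p) ℝ}

lemma R_mul_inv (G : GSVD B C) : G.R * G.R⁻¹ = 1 := mul_nonsing_inv _ G.R_nonsingular

lemma inv_mul_R (G : GSVD B C) : G.R⁻¹ * G.R = 1 := nonsing_inv_mul _ G.R_nonsingular

lemma W_mul_transpose (G : GSVD B C) : G.W * G.Wᵀ = 1 := 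
  mul_transpose_of_mem_orthogonalGroup G.W_orth

lemma W_transpose_mul (G : GSVD B C) : G.Wᵀ * G.W = 1 := 
  transpose_mul_of_mem_orthogonalGroup G.W_orth

lemma Q_mul_transpose (G : GSVD B C) : G.Q * G.Qᵀ = 1 := 
  mul_transpose_of_mem_orthogonalGroup G.Q_orth

lemma exists_M_mul_eq_one (G : GSVD B C) :
    ∃ N : Matrix ((Fin G.r ⊕ (Fin G.s ⊕ Fin G.t)) ⊕ Fin G.d) (Fin n) ℝ, G.M * N = 1 := by
  refine ⟨(fromBlocks (G.Wᵀ * G.R) 0 0 1 : Matrix ((Fin G.r ⊕ (Fin G.s ⊕ Fin G.t)) ⊕ Fin G.d)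
        ((Fin G.r ⊕ (Fin G.s ⊕ Fin G.t)) ⊕ Fin G.d) ℝ) *
    G.Qᵀ.submatrix (blocks4 G.n_eq) id, ?_⟩
  have h : G.R⁻¹ * G.W * (G.Wᵀ * G.R) = 1 := by
    rw [Matrix.mul_assoc, ← Matrix.mul_assoc G.W, G.W_mul_transpose, Matrix.one_mul, G.inv_mul_R]
  rw [M, Matrix.mul_assoc, ← Matrix.mul_assoc (fromBlocks _ _ _ _), fromBlocks_multiply]
  simp only [h, Matrix.mul_zero, Matrix.zero_mul, add_zero, zero_add, Matrix.mul_one,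
    fromBlocks_one, Matrix.one_mul, submatrix_mul_equiv, G.Q_mul_transpose, submatrix_id_id]

/-- The factor R⁻¹ W in `G.M` cancels Wᵀ R. Applied to both B and Cᵀ. -/
lemma orthogonal_mul_M (G : GSVD B C) {a b : Type*} [Fintype a] [Fintype b]
    [DecidableEq a] (D : Matrix a (Fin n) ℝ) (P : Matrix a a ℝ) (e : b ≃ a)
    (S : Matrix b (Fin G.r ⊕ (Fin G.s ⊕ Fin G.t)) ℝ)
    (h : (Pᵀ * D * G.Q).submatrix e (blocks4 G.n_eq) = S * fromCols (G.Wᵀ * G.R) 0) :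
    (Pᵀ * D * G.M).submatrix e id =
      S * (fromCols 1 0 :
        Matrix (Fin G.r ⊕ (Fin G.s ⊕ Fin G.t)) ((Fin G.r ⊕ (Fin G.s ⊕ Fin G.t)) ⊕ Fin G.d) ℝ) := by
  have hR : G.Wᵀ * G.R * (G.R⁻¹ * G.W) = 1 := by
    rw [Matrix.mul_assoc, ← Matrix.mul_assoc G.R, G.R_mul_inv, Matrix.one_mul, G.W_transpose_mul]
  have : (Pᵀ * D * G.M).submatrix e id =
      (Pᵀ * D * G.Q).submatrix e (blocks4 G.n_eq) *
        (fromBlocks (G.R⁻¹ * G.W) 0 0 1 : Matrix ((Fin G.r ⊕ (Fin G.s ⊕ Fin G.t)) ⊕ Fin G.d)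
          ((Fin G.r ⊕ (Fin G.s ⊕ Fin G.t)) ⊕ Fin G.d) ℝ) := by
    rw [M, ← Matrix.mul_assoc]
    rfl
  rw [this, h, Matrix.mul_assoc, fromCols_mul_fromBlocks]
  rw [hR, Matrix.mul_zero, Matrix.mul_zero, add_zero, Matrix.zero_mul, zero_add]

lemma sumSq_residual (G : GSVD B C) (A : Matrix (Fin m) (Fin p) ℝ)
    (Y : Matrix ((Fin G.r ⊕ (Fin G.s ⊕ Fin G.t)) ⊕ Fin G.d)
      ((Fin G.r ⊕ (Fin G.s ⊕ Fin G.t)) ⊕ Fin G.d) ℝ) :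
    sumSq (A - B * (G.M * Y * G.Mᵀ) * C) =
      sumSq (G.tildeA A - sigmaB G.r G.t G.u G.β * Y.toBlocks₁₁ * (sigmaC G.r G.t G.v G.γ)ᵀ) := by
  rw [← sumSq_orthogonal G.U_orth G.V_orth,
    ← sumSq_submatrix (G.Uᵀ * (A - B * (G.M * Y * G.Mᵀ) * C) * G.V) (blocks3 G.m_eq)
      (blocks3 G.p_eq)]
  have hB := G.orthogonal_mul_M B G.U (blocks3 G.m_eq) (sigmaB G.r G.t G.u G.β) G.B_eq
  have hC := G.orthogonal_mul_M Cᵀ G.V (blocks3 G.p_eq) (sigmaC G.r G.t G.v G.γ) G.C_eq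
  have hC' : (G.Mᵀ * C * G.V).submatrix id (blocks3 G.p_eq) =
      (fromRows 1 0 :
        Matrix ((Fin G.r ⊕ (Fin G.s ⊕ Fin G.t)) ⊕ Fin G.d) (Fin G.r ⊕ (Fin G.s ⊕ Fin G.t)) ℝ) *
        (sigmaC G.r G.t G.v G.γ)ᵀ := by
    have := congrArg transpose hC
    simpa [transpose_submatrix, transpose_mul, Matrix.mul_assoc, transpose_fromCols] using this
  have key : (G.Uᵀ * (A - B * (G.M * Y * G.Mᵀ) * C) * G.V).submatrix (blocks3 G.m_eq)
      (blocks3 G.p_eq) = G.tildeA A - (G.Uᵀ * B * G.M).submatrix (blocks3 G.m_eq) id * Y *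
        (G.Mᵀ * C * G.V).submatrix id (blocks3 G.p_eq) := by
    have : G.Uᵀ * (A - B * (G.M * Y * G.Mᵀ) * C) * G.V = G.Uᵀ * A * G.V -
        (G.Uᵀ * B * G.M) * Y * (G.Mᵀ * C * G.V) := by
      simp only [Matrix.mul_sub, Matrix.sub_mul, Matrix.mul_assoc]
    rw [this]
    rfl
  have hY : (fromCols 1 0 :
        Matrix (Fin G.r ⊕ (Fin G.s ⊕ Fin G.t)) ((Fin G.r ⊕ (Fin G.s ⊕ Fin G.t)) ⊕ Fin G.d) ℝ) * Y *
      (fromRows 1 0 :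
        Matrix ((Fin G.r ⊕ (Fin G.s ⊕ Fin G.t)) ⊕ Fin G.d) (Fin G.r ⊕ (Fin G.s ⊕ Fin G.t)) ℝ) =
      Y.toBlocks₁₁ := by
    conv_lhs => rw [← fromBlocks_toBlocks Y]
    rw [fromCols_mul_fromBlocks, fromCols_mul_fromRows]
    simp
  rw [key, hB, hC', ← hY]
  simp only [Matrix.mul_assoc]

/-- The last block row of Σ_B and the first block column of Σ_Cᵀ vanish, so the first three sums do
not involve Y. The other four each involve a single block of Y, on or above the diagonal. -/
lemma sumSq_residual_blocks (G : GSVD B C) (A : Matrix (Fin m) (Fin p) ℝ)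
    (Y : Matrix (Fin G.r ⊕ (Fin G.s ⊕ Fin G.t)) (Fin G.r ⊕ (Fin G.s ⊕ Fin G.t)) ℝ) :
    sumSq (G.tildeA A - sigmaB G.r G.t G.u G.β * Y * (sigmaC G.r G.t G.v G.γ)ᵀ) =
      (∑ i, ∑ j, G.tildeA A (.inl i) (.inl j) ^ 2) +
      (∑ i, ∑ j, G.tildeA A (.inr i) (.inl j) ^ 2) +
      (∑ i, ∑ j, G.tildeA A (.inr (.inr i)) (.inr j) ^ 2) +
      (∑ i, ∑ j, (G.A₁₂ A i j - Y (.inl i) (.inr (.inl j)) * G.γ j) ^ 2) +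
      (∑ i, ∑ j, (G.A₁₃ A i j - Y (.inl i) (.inr (.inr j))) ^ 2) +
      (∑ i, ∑ j, (G.A₂₃ A i j - G.β i * Y (.inr (.inl i)) (.inr (.inr j))) ^ 2) +
      (∑ i, ∑ j, (G.A₂₂ A i j - G.σ i j * Y (.inr (.inl i)) (.inr (.inl j))) ^ 2) := by
  simp only [sumSq, Fintype.sum_sum_type, Matrix.sub_apply, mul_apply, sigmaB, sigmaC,
    transpose_apply, fromBlocks_apply₁₁, fromBlocks_apply₁₂, fromBlocks_apply₂₁, fromBlocks_apply₂₂,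
    Matrix.zero_apply,
    one_apply, diagonal_apply, ite_mul, mul_ite, zero_mul, mul_zero, one_mul, mul_one, add_zero,
    zero_add, Finset.sum_const_zero, Finset.sum_ite_eq, Finset.mem_univ, if_true, sub_zero,
    Finset.sum_add_distrib, A₁₂, A₁₃, A₂₂, A₂₃, toBlocks₁₂, toBlocks₂₂, toBlocks₁₁, toCols₁,
    toCols₂,
    of_apply, σ, mul_right_comm]
  ring

/-- The pairwise least-squares inequality for entries tied by `y' = ε y`. -/
lemma pair_sq_le {a a' c c' ε x x' y y' : ℝ} (hε : ε ^ 2 = 1) (hc : c ^ 2 + c' ^ 2 ≠ 0)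
    (hx : x = (a * c + ε * (a' * c')) / (c ^ 2 + c' ^ 2)) (hx' : x' = ε * x)
    (hy : y' = ε * y) :
    (a - c * x) ^ 2 + (a' - c' * x') ^ 2 ≤ (a - c * y) ^ 2 + (a' - c' * y') ^ 2 := by
  have h : x * (c ^ 2 + c' ^ 2) = a * c + ε * (a' * c') := by rw [hx]; field_simp
  subst hx' hy
  -- Completing the square: x is the vertex of the quadratic in y.
  have : (a - c * y) ^ 2 + (a' - c' * (ε * y)) ^ 2 -
      ((a - c * x) ^ 2 + (a' - c' * (ε * x)) ^ 2) = (c ^ 2 + c' ^ 2) * (y - x) ^ 2 := by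
    linear_combination 2 * (y - x) * h + c' ^ 2 * (y ^ 2 - x ^ 2) * hε
  nlinarith [mul_nonneg (add_nonneg (sq_nonneg c) (sq_nonneg c')) (sq_nonneg (y - x))]

/-- Hence the default value 0 of the middle block is never taken. -/
lemma σ_sq_ne_zero (G : GSVD B C) (i j : Fin G.s) : G.σ i j ^ 2 + G.σ j i ^ 2 ≠ 0 := by
  have h : ∀ i j, 0 < G.σ i j := fun i j => mul_pos (G.β_mem i).1 (G.γ_mem j).1
  have := h i j
  positivity

/-- The sign ε = 1 is the symmetric case and ε = -1 the skew-symmetric one. -/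
lemma norm_residual_le (G : GSVD B C) (A : Matrix (Fin m) (Fin p) ℝ) {ε : ℝ} (hε : ε ^ 2 = 1)
    (Z : Matrix ((Fin G.r ⊕ (Fin G.s ⊕ Fin G.t)) ⊕ Fin G.d)
      ((Fin G.r ⊕ (Fin G.s ⊕ Fin G.t)) ⊕ Fin G.d) ℝ)
    (h₁₂ : ∀ i j, Z (.inl (.inl i)) (.inl (.inr (.inl j))) = G.A₁₂ A i j * (G.γ j)⁻¹)
    (h₁₃ : ∀ i j, Z (.inl (.inl i)) (.inl (.inr (.inr j))) = G.A₁₃ A i j)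
    (h₂₃ : ∀ i j, Z (.inl (.inr (.inl i))) (.inl (.inr (.inr j))) = (G.β i)⁻¹ * G.A₂₃ A i j)
    (h₂₂ : ∀ i j, Z (.inl (.inr (.inl i))) (.inl (.inr (.inl j))) =
      (G.A₂₂ A i j * G.σ i j + ε * (G.A₂₂ A j i * G.σ j i)) / (G.σ i j ^ 2 + G.σ j i ^ 2))
    (hZ : Zᵀ = ε • Z) {X : Matrix (Fin n) (Fin n) ℝ} (hX : Xᵀ = ε • X) :
    ‖A - B * (G.M * Z * G.Mᵀ) * C‖ ≤ ‖A - B * X * C‖ := by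
  obtain ⟨N, hN⟩ := G.exists_M_mul_eq_one
  obtain ⟨Y, hY, hXY⟩ : ∃ Y : Matrix ((Fin G.r ⊕ (Fin G.s ⊕ Fin G.t)) ⊕ Fin G.d)
      ((Fin G.r ⊕ (Fin G.s ⊕ Fin G.t)) ⊕ Fin G.d) ℝ, Yᵀ = ε • Y ∧ X = G.M * Y * G.Mᵀ := by
    refine ⟨N * X * Nᵀ, ?_, ?_⟩
    · simp [transpose_mul, hX, Matrix.mul_assoc]
    · have : G.M * (N * X * Nᵀ) * G.Mᵀ = (G.M * N) * X * (G.M * N)ᵀ := by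
        simp only [transpose_mul, Matrix.mul_assoc]
      rw [this, hN]
      simp
  rw [hXY, frobenius_norm_le_iff, G.sumSq_residual, G.sumSq_residual, G.sumSq_residual_blocks,
    G.sumSq_residual_blocks]
  have hβ : ∀ i, G.β i ≠ 0 := fun i => (G.β_mem i).1.ne'
  have hγ : ∀ i, G.γ i ≠ 0 := fun i => (G.γ_mem i).1.ne'
  -- Doubling the sum puts each entry beside its mirror image; a diagonal entry is paired with
  -- itself, so it needs no separate case.
  have swap : ∀ f : Fin G.s → Fin G.s → ℝ, 2 * ∑ i, ∑ j, f i j = ∑ i, ∑ j, (f i j + f j i) := by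
    intro f
    simp only [Finset.sum_add_distrib]
    rw [Finset.sum_comm (f := fun i j => f j i)]
    ring
  have h22 : (∑ i, ∑ j, (G.A₂₂ A i j -
        G.σ i j * Z.toBlocks₁₁ (.inr (.inl i)) (.inr (.inl j))) ^ 2) ≤
      ∑ i, ∑ j, (G.A₂₂ A i j - G.σ i j * Y.toBlocks₁₁ (.inr (.inl i)) (.inr (.inl j))) ^ 2 := by
    refine le_of_mul_le_mul_left ?_ (zero_lt_two (α := ℝ))
    rw [swap, swap]
    refine Finset.sum_le_sum fun i _ => Finset.sum_le_sum fun j _ => ?_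
    refine pair_sq_le hε (G.σ_sq_ne_zero i j) (h₂₂ i j) ?_ ?_
    · exact congrFun (congrFun hZ _) _
    · exact congrFun (congrFun hY _) _
  have z : ∀ i j, G.A₁₂ A i j - Z.toBlocks₁₁ (.inl i) (.inr (.inl j)) * G.γ j = 0 := by
    intro i j
    simp [toBlocks₁₁, h₁₂, hγ]
  have z' : ∀ i j, G.A₁₃ A i j - Z.toBlocks₁₁ (.inl i) (.inr (.inr j)) = 0 := by
    intro i j
    simp [toBlocks₁₁, h₁₃]
  have z'' : ∀ i j, G.A₂₃ A i j - G.β i * Z.toBlocks₁₁ (.inr (.inl i)) (.inr (.inr j)) = 0 := by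
    intro i j
    simp [toBlocks₁₁, h₂₃, hβ]
  simp only [z, z', z'']
  have nn : ∀ {a b : ℕ} (f : Fin a → Fin b → ℝ), ∑ i, ∑ j, (0 : ℝ) ^ 2 ≤ ∑ i, ∑ j, f i j ^ 2 :=
    fun f => Finset.sum_le_sum fun i _ => Finset.sum_le_sum fun j _ => by simpa using sq_nonneg _
  exact add_le_add (add_le_add (add_le_add (add_le_add le_rfl (nn _)) (nn _)) (nn _)) h22

/-! ### The explicit symmetric and skew-symmetric solutions. -/

lemma SB_inv (G : GSVD B C) : G.SB⁻¹ = diagonal fun i => (G.β i)⁻¹ := by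
  refine inv_eq_right_inv ?_
  rw [SB, diagonal_mul_diagonal, ← diagonal_one]
  exact congrArg diagonal (funext fun i => mul_inv_cancel₀ (G.β_mem i).1.ne')

lemma SC_inv (G : GSVD B C) : G.SC⁻¹ = diagonal fun i => (G.γ i)⁻¹ := by
  refine inv_eq_right_inv ?_
  rw [SC, diagonal_mul_diagonal, ← diagonal_one]
  exact congrArg diagonal (funext fun i => mul_inv_cancel₀ (G.γ_mem i).1.ne')

lemma symmX₂₂_apply (G : GSVD B C) (A : Matrix (Fin m) (Fin p) ℝ) (i j : Fin G.s) :
    G.symmX₂₂ A i j =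
      (G.A₂₂ A i j * G.σ i j + G.A₂₂ A j i * G.σ j i) / (G.σ i j ^ 2 + G.σ j i ^ 2) := by
  simp [symmX₂₂, G.σ_sq_ne_zero i j]

lemma skewX₂₂_apply (G : GSVD B C) (A : Matrix (Fin m) (Fin p) ℝ) (i j : Fin G.s) :
    G.skewX₂₂ A i j =
      (G.A₂₂ A i j * G.σ i j - G.A₂₂ A j i * G.σ j i) / (G.σ i j ^ 2 + G.σ j i ^ 2) := by
  simp [skewX₂₂, G.σ_sq_ne_zero i j]

lemma transpose_symmX₂₂ (G : GSVD B C) (A : Matrix (Fin m) (Fin p) ℝ) :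
    (G.symmX₂₂ A)ᵀ = G.symmX₂₂ A := by
  ext i j
  rw [transpose_apply, symmX₂₂_apply, symmX₂₂_apply, add_comm, add_comm (_ ^ 2)]

lemma transpose_skewX₂₂ (G : GSVD B C) (A : Matrix (Fin m) (Fin p) ℝ) :
    (G.skewX₂₂ A)ᵀ = -G.skewX₂₂ A := by
  ext i j
  rw [transpose_apply, neg_apply, skewX₂₂_apply, skewX₂₂_apply, add_comm (_ ^ 2), ← neg_div,
    neg_sub]

lemma transpose_symmBlocks (G : GSVD B C) (A : Matrix (Fin m) (Fin p) ℝ) :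
    (G.symmBlocks A)ᵀ = G.symmBlocks A := by
  simp [symmBlocks, fromBlocks_transpose, transpose_fromCols, transpose_fromRows,
    transpose_symmX₂₂]

lemma transpose_skewBlocks (G : GSVD B C) (A : Matrix (Fin m) (Fin p) ℝ) :
    (G.skewBlocks A)ᵀ = -G.skewBlocks A := by
  simp [skewBlocks, fromBlocks_transpose, transpose_fromCols, transpose_fromRows,
    transpose_skewX₂₂, fromBlocks_neg, fromCols_neg, fromRows_neg]

lemma transpose_symmSol (G : GSVD B C) (A : Matrix (Fin m) (Fin p) ℝ) :
    (G.symmSol A)ᵀ = G.symmSol A := by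
  simp [symmSol, transpose_mul, transpose_symmBlocks, Matrix.mul_assoc]

lemma transpose_skewSol (G : GSVD B C) (A : Matrix (Fin m) (Fin p) ℝ) :
    (G.skewSol A)ᵀ = -G.skewSol A := by
  simp [skewSol, transpose_mul, transpose_skewBlocks, Matrix.mul_assoc]

lemma norm_symmSol_le (G : GSVD B C) (A : Matrix (Fin m) (Fin p) ℝ)
    {X : Matrix (Fin n) (Fin n) ℝ} (hX : Xᵀ = X) :
    ‖A - B * G.symmSol A * C‖ ≤ ‖A - B * X * C‖ := by
  refine G.norm_residual_le A (ε := 1) (by norm_num) (G.symmBlocks A) ?_ ?_ ?_ ?_ ?_ ?_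
  · intro i j
    simp [symmBlocks, SC_inv]
  · intro i j
    simp [symmBlocks]
  · intro i j
    simp [symmBlocks, SB_inv]
  · intro i j
    simp [symmBlocks, symmX₂₂_apply]
  · simp [transpose_symmBlocks]
  · simp [hX]

lemma norm_skewSol_le (G : GSVD B C) (A : Matrix (Fin m) (Fin p) ℝ)
    {X : Matrix (Fin n) (Fin n) ℝ} (hX : Xᵀ = -X) :
    ‖A - B * G.skewSol A * C‖ ≤ ‖A - B * X * C‖ := by
  refine G.norm_residual_le A (ε := -1) (by norm_num) (G.skewBlocks A) ?_ ?_ ?_ ?_ ?_ ?_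
  · intro i j
    simp [skewBlocks, SC_inv]
  · intro i j
    simp [skewBlocks]
  · intro i j
    simp [skewBlocks, SB_inv]
  · intro i j
    simp [skewBlocks, skewX₂₂_apply, sub_eq_add_neg]
  · simp [transpose_skewBlocks]
  · simp [hX]

end GSVD

/-! ### Singular values, spectral theorem and orthogonal completion. -/

-- Singular values are square roots of the sorted roots of the characteristic polynomial of Kᵀ K.
-- This form allows matrices of different sizes, here R and the stacked matrix, to be compared index
-- by index.
open Polynomial in
lemma matSingularValues_of_charpoly {a b : Type} [Fintype a] [Fintype b] [DecidableEq b] {N : ℕ}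
    (K : Matrix a b ℝ) (f : Fin N → ℝ) (hf : Antitone f)
    (h : (Kᵀ * K).charpoly = ∏ i, (X - C (f i))) (j : ℕ) :
    matSingularValues K j = if h : j < N then √(f ⟨j, h⟩) else 0 := by
  classical
  -- Comparing degrees in `h` forces N to be the number of columns.
  have hN : Module.finrank ℝ (EuclideanSpace ℝ b) = N := by
    have := congrArg natDegree h
    rw [charpoly_natDegree_eq_dim, natDegree_prod_of_monic _ _ fun i _ => monic_X_sub_C _] at this
    simpa using this
  unfold matSingularValues
  split_ifs with hj
  · rw [LinearMap.singularValues_of_lt _ hN hj]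
    congr 1
    have hsymm := (toEuclideanLin K).isSymmetric_adjoint_comp_self
    have hchar : ((toEuclideanLin K).adjoint ∘ₗ toEuclideanLin K).charpoly =
        ∏ i, (X - C (f i)) := by
      rw [← toEuclideanLin_conjTranspose_eq_adjoint, conjTranspose_eq_transpose_of_trivial, ← h,
        ← charpoly_toLin _ (EuclideanSpace.basisFun b ℝ).toBasis]
      congr 1
      exact (toLin_mul (EuclideanSpace.basisFun b ℝ).toBasis
        (EuclideanSpace.basisFun a ℝ).toBasis (EuclideanSpace.basisFun b ℝ).toBasis Kᵀ K).symm
    have hroots : ((toEuclideanLin K).adjoint ∘ₗ toEuclideanLin K).charpoly.roots =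
        (List.ofFn f : Multiset ℝ) := by
      rw [hchar, roots_prod _ _ (by simp [Finset.prod_ne_zero_iff, X_sub_C_ne_zero])]
      simp [Fin.univ_val_map]
    have key := hsymm.sort_roots_charpoly_eq_eigenvalues hN
    have hsort : (Multiset.map RCLike.re (List.ofFn f : Multiset ℝ)).sort (· ≥ ·) =
        List.ofFn f := by
      have : (RCLike.re : ℝ → ℝ) = id := rfl
      rw [this, Multiset.map_id, Multiset.coe_sort]
      refine List.mergeSort_of_pairwise ?_
      simp_rw [decide_eq_true_eq, ← List.sortedGE_iff_pairwise]
      exact hf.sortedGE_ofFn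
    rw [hroots, hsort, List.ofFn_inj] at key
    rw [← key]
  · exact LinearMap.singularValues_of_finrank_le _ (by omega)

lemma OrthonormalBasis.of_mem_orthogonalGroup {n : ℕ}
    (e : OrthonormalBasis (Fin n) ℝ (EuclideanSpace ℝ (Fin n))) :
    (of fun i j => e j i : Matrix (Fin n) (Fin n) ℝ) ∈ orthogonalGroup (Fin n) ℝ := by
  rw [mem_orthogonalGroup_iff']
  ext i j
  have := orthonormal_iff_ite.1 e.orthonormal i j
  simpa [mul_apply, star_eq_conjTranspose, one_apply, PiLp.inner_apply, mul_comm] using this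

lemma exists_orthogonal_diagonal {n : ℕ} {S : Matrix (Fin n) (Fin n) ℝ} (hS : Sᵀ = S) :
    ∃ Q ∈ orthogonalGroup (Fin n) ℝ, ∃ l : Fin n → ℝ, Antitone l ∧
      S * Q = Q * diagonal l := by
  have hT : (toEuclideanLin S).IsSymmetric := by
    rw [isSymmetric_toEuclideanLin_iff, IsHermitian, conjTranspose_eq_transpose_of_trivial, hS]
  have hn : Module.finrank ℝ (EuclideanSpace ℝ (Fin n)) = n := by simp
  let e := hT.eigenvectorBasis hn
  refine ⟨of fun i j => e j i, e.of_mem_orthogonalGroup, hT.eigenvalues hn,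
    hT.eigenvalues_antitone hn, ?_⟩
  · ext i j
    have := congrArg (fun v => v i) (hT.apply_eigenvectorBasis hn j)
    rw [mul_diagonal, of_apply, mul_comm _ (hT.eigenvalues hn j)]
    exact this

/-- Orthonormal columns extend to an orthogonal matrix, at prescribed positions. -/
lemma exists_orthogonal_extension {m : ℕ} {κ : Type*} [Fintype κ] [DecidableEq κ]
    (N : Matrix (Fin m) κ ℝ) (hN : Nᵀ * N = 1) (φ : κ → Fin m) (hφ : Function.Injective φ) :
    ∃ U ∈ orthogonalGroup (Fin m) ℝ, ∀ a x, U a (φ x) = N a x := by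
  let v : Fin m → EuclideanSpace ℝ (Fin m) :=
    Function.extend φ (fun x => WithLp.toLp 2 fun a => N a x) 0
  have hv : ∀ x, v (φ x) = WithLp.toLp 2 fun a => N a x := fun x => hφ.extend_apply _ _ x
  have ho : Orthonormal ℝ ((Set.range φ).domRestrict v) := by
    rw [orthonormal_iff_ite]
    intro i j
    obtain ⟨x, hx⟩ := i.2
    obtain ⟨y, hy⟩ := j.2
    have hij : i = j ↔ x = y := by rw [Subtype.ext_iff, ← hx, ← hy, hφ.eq_iff]
    have := congrFun (congrFun hN x) y
    simp only [hij, Set.domRestrict_apply, ← hx, ← hy, hv]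
    simpa [PiLp.inner_apply, mul_apply, one_apply, mul_comm] using this
  obtain ⟨e, he⟩ := ho.exists_orthonormalBasis_extension_of_card_eq (by simp)
  refine ⟨of fun i j => e j i, e.of_mem_orthogonalGroup, ?_⟩
  · intro a x
    simp [he (φ x) ⟨x, rfl⟩, hv]

/-- Used to read block sizes off decreasing eigenvalues; r is the first index where P fails, or k.
-/
lemma exists_threshold {k : ℕ} {P : Fin k → Prop} (hP : ∀ i j, i ≤ j → P j → P i) :
    ∃ r ≤ k, ∀ i : Fin k, P i ↔ (i : ℕ) < r := by
  classical
  by_cases h : ∃ r, ∃ h : r < k, ¬ P ⟨r, h⟩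
  · refine ⟨Nat.find h, (Nat.find_spec h).1.le, fun i => ⟨fun hi => ?_, fun hi => ?_⟩⟩
    · by_contra hlt
      obtain ⟨h1, h2⟩ := Nat.find_spec h
      exact h2 (hP _ i (not_lt.1 hlt) hi)
    · by_contra hn
      exact Nat.find_min h hi ⟨i.2, hn⟩
  · push Not at h
    exact ⟨k, le_rfl, fun i => ⟨fun _ => i.2, fun _ => h i i.2⟩⟩

/-- A matrix with orthogonal columns, the nonzero ones being at `ψ`, is a product of an orthogonal
matrix and a scaled partial permutation. -/
lemma exists_orthogonal_columns {m : ℕ} {κ ι : Type*} [Fintype κ] [DecidableEq κ]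
    [Fintype ι] [DecidableEq ι]
    (Z : Matrix (Fin m) ι ℝ) (l : ι → ℝ) (hZ : Zᵀ * Z = diagonal l)
    (ψ : κ → ι) (hψ : Function.Injective ψ) (hl : ∀ x, 0 < l (ψ x)) :
    (Fintype.card κ ≤ m) ∧ ∀ φ : κ → Fin m, Function.Injective φ →
      ∃ U ∈ orthogonalGroup (Fin m) ℝ, ∀ a x, Z a (ψ x) = U a (φ x) * √(l (ψ x)) := by
  have hN : (of fun a x => Z a (ψ x) / √(l (ψ x)) : Matrix (Fin m) κ ℝ)ᵀ *
      (of fun a x => Z a (ψ x) / √(l (ψ x)) : Matrix (Fin m) κ ℝ) = 1 := by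
    ext x y
    have h := congrFun (congrFun hZ (ψ x)) (ψ y)
    have hx := Real.sqrt_pos.2 (hl x)
    simp only [mul_apply, transpose_apply, of_apply, diagonal_apply, one_apply,
      hψ.eq_iff] at h ⊢
    simp only [div_mul_div_comm]
    rw [← Finset.sum_div, h]
    split_ifs with hxy
    · subst hxy
      rw [Real.mul_self_sqrt (hl x).le, div_self (hl x).ne']
    · simp
  refine ⟨?_, fun φ hφ => ?_⟩
  -- A family of orthonormal columns in ℝᵐ has at most m members; this later makes the sizes u and v
  -- nonnegative.
  · have h1 : Fintype.card κ = (1 : Matrix κ κ ℝ).rank := by simp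
    rw [h1, ← hN]
    exact ((rank_mul_le_right _ _).trans (rank_le_card_height _)).trans (by simp)
  · obtain ⟨U, hU, h⟩ := exists_orthogonal_extension _ hN φ hφ
    refine ⟨U, hU, fun a x => ?_⟩
    rw [h, of_apply, div_mul_cancel₀ _ (Real.sqrt_pos.2 (hl x)).ne']

/-- The diagonal of Zᵀ Z holds the squared column lengths. -/
lemma column_eq_zero {μ ι : Type*} [Fintype μ] [DecidableEq ι]
    {Z : Matrix μ ι ℝ} {l : ι → ℝ} (hZ : Zᵀ * Z = diagonal l) {j : ι} (hj : l j = 0)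
    (a : μ) : Z a j = 0 := by
  have h := congrFun (congrFun hZ j) j
  simp only [mul_apply, transpose_apply, diagonal_apply_eq, hj] at h
  have := (Finset.sum_eq_zero_iff_of_nonneg fun i _ => mul_self_nonneg (Z i j)).1 h a
    (Finset.mem_univ a)
  simpa using this

/-! ### The cosine-sine decomposition. -/

lemma blocks3_inl {a b c N : ℕ} (h : a + (b + c) = N) (i : Fin a) :
    (blocks3 h (.inl i) : ℕ) = i := by
  simp [blocks3]

lemma blocks3_inr_inl {a b c N : ℕ} (h : a + (b + c) = N) (i : Fin b) :
    (blocks3 h (.inr (.inl i)) : ℕ) = a + i := by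
  simp [blocks3]

lemma blocks3_inr_inr {a b c N : ℕ} (h : a + (b + c) = N) (i : Fin c) :
    (blocks3 h (.inr (.inr i)) : ℕ) = a + (b + i) := by
  simp [blocks3]

lemma blocks4_inl {a b c d N : ℕ} (h : a + (b + c) + d = N) (i : Fin a ⊕ (Fin b ⊕ Fin c)) :
    (blocks4 h (.inl i) : ℕ) = blocks3 rfl i := by
  simp [blocks4]

lemma blocks4_inr {a b c d N : ℕ} (h : a + (b + c) + d = N) (i : Fin d) :
    (blocks4 h (.inr i) : ℕ) = a + (b + c) + i := by
  simp [blocks4]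

/-- The cosine-sine decomposition of two stacked blocks with orthonormal columns. -/
lemma exists_cs_decomposition {m p k : ℕ} (P₁ : Matrix (Fin m) (Fin k) ℝ)
    (P₂ : Matrix (Fin p) (Fin k) ℝ) (h : P₁ᵀ * P₁ + P₂ᵀ * P₂ = 1) :
    ∃ (r s t u v : ℕ) (hk : r + (s + t) = k) (hm : r + (s + u) = m) (hp : v + (s + t) = p)
      (U : Matrix (Fin m) (Fin m) ℝ) (V : Matrix (Fin p) (Fin p) ℝ)
      (W : Matrix (Fin k) (Fin k) ℝ) (β γ : Fin s → ℝ),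
      U ∈ orthogonalGroup (Fin m) ℝ ∧ V ∈ orthogonalGroup (Fin p) ℝ ∧
      W ∈ orthogonalGroup (Fin k) ℝ ∧ Antitone β ∧ Monotone γ ∧
      (∀ i, 0 < β i ∧ β i < 1) ∧ (∀ i, 0 < γ i ∧ γ i < 1) ∧
      (P₁ * W).submatrix id (blocks3 hk) = U.submatrix id (blocks3 hm) * sigmaB r t u β ∧
      (P₂ * W).submatrix id (blocks3 hk) = V.submatrix id (blocks3 hp) * sigmaC r t v γ := by
  obtain ⟨W, hW, l, hl, hPW⟩ := exists_orthogonal_diagonal (S := P₁ᵀ * P₁)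
    (by rw [transpose_mul, transpose_transpose])
  have hWW := transpose_mul_of_mem_orthogonalGroup hW
  have h₁ : (P₁ * W)ᵀ * (P₁ * W) = diagonal l := by
    rw [transpose_mul, Matrix.mul_assoc, ← Matrix.mul_assoc _ P₁, hPW, ← Matrix.mul_assoc, hWW,
      Matrix.one_mul]
  have h₂ : (P₂ * W)ᵀ * (P₂ * W) = diagonal fun i => 1 - l i := by
    have : P₂ᵀ * P₂ = 1 - P₁ᵀ * P₁ := by rw [← h, add_sub_cancel_left]
    rw [transpose_mul, Matrix.mul_assoc, ← Matrix.mul_assoc _ P₂, this, Matrix.sub_mul, hPW,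
      Matrix.one_mul, Matrix.mul_sub, ← Matrix.mul_assoc, hWW, Matrix.one_mul, ← diagonal_one,
      diagonal_sub]
  have nonneg_of : ∀ {q : ℕ} (Z : Matrix (Fin q) (Fin k) ℝ) (d : Fin k → ℝ),
      Zᵀ * Z = diagonal d → ∀ i, 0 ≤ d i := by
    intro q Z d hZ i
    rw [← diagonal_apply_eq d i, ← hZ, mul_apply]
    exact Finset.sum_nonneg fun a _ => mul_self_nonneg (Z a i)
  have hl0 : ∀ i, 0 ≤ l i := nonneg_of _ _ h₁
  have hl1 : ∀ i, l i ≤ 1 := fun i => sub_nonneg.1 (nonneg_of _ _ h₂ i)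
  -- As 0 ≤ l ≤ 1 decreases, r counts the eigenvalues equal to 1 and q the positive ones; s = q - r
  -- counts those strictly between.
  obtain ⟨r, hr, hr'⟩ := exists_threshold (P := fun i => 1 ≤ l i)
    fun i j hij hj => hj.trans (hl hij)
  obtain ⟨q, hq, hq'⟩ := exists_threshold (P := fun i => 0 < l i)
    fun i j hij hj => hj.trans_le (hl hij)
  have hrq : r ≤ q := by
    by_contra hlt
    have hlt : q < r := not_le.1 hlt
    have h1 := (hr' ⟨q, by omega⟩).2 hlt
    have h2 := (hq' ⟨q, by omega⟩).1 (zero_lt_one.trans_le h1)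
    exact lt_irrefl _ h2
  obtain ⟨s, rfl⟩ := Nat.exists_eq_add_of_le hrq
  obtain ⟨t, hk⟩ := Nat.exists_eq_add_of_le hq
  have hk : r + (s + t) = k := by omega
  have e1 : ∀ i, l (blocks3 hk (.inl i)) = 1 := fun i =>
    le_antisymm (hl1 _) ((hr' _).2 (by rw [blocks3_inl]; exact i.2))
  have e2 : ∀ i, 0 < l (blocks3 hk (.inr (.inl i))) := fun i =>
    (hq' _).2 (by rw [blocks3_inr_inl]; omega)
  have e2' : ∀ i, l (blocks3 hk (.inr (.inl i))) < 1 := fun i => by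
    rw [← not_le, hr', blocks3_inr_inl]; omega
  have e3 : ∀ i, l (blocks3 hk (.inr (.inr i))) = 0 := fun i => by
    refine le_antisymm ?_ (hl0 _)
    rw [← not_lt, hq', blocks3_inr_inr]; omega
  obtain ⟨hcm, HU⟩ := exists_orthogonal_columns (P₁ * W) l h₁
    (κ := Fin r ⊕ Fin s) (blocks3 hk ∘ Sum.map id Sum.inl)
    ((blocks3 hk).injective.comp (Function.injective_id.sumMap Sum.inl_injective))
    (by rintro (i | i)
        · simp [e1]
        · exact e2 i)
  -- Column i of P₂ W has squared length 1 - l i, nonzero exactly on the last two blocks.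
  obtain ⟨hcp, HV⟩ := exists_orthogonal_columns (P₂ * W) _ h₂
    (κ := Fin s ⊕ Fin t) (blocks3 hk ∘ Sum.inr)
    ((blocks3 hk).injective.comp Sum.inr_injective)
    (by rintro (i | i)
        · exact sub_pos.2 (e2' i)
        · simp [e3])
  simp only [Fintype.card_sum, Fintype.card_fin] at hcm hcp
  obtain ⟨u, hm⟩ := Nat.exists_eq_add_of_le hcm
  obtain ⟨v, hp⟩ := Nat.exists_eq_add_of_le hcp
  have hm : r + (s + u) = m := by omega
  have hp : v + (s + t) = p := by omega
  obtain ⟨U, hU, hU'⟩ := HU (blocks3 hm ∘ Sum.map id Sum.inl)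
    ((blocks3 hm).injective.comp (Function.injective_id.sumMap Sum.inl_injective))
  obtain ⟨V, hV, hV'⟩ := HV (blocks3 hp ∘ Sum.inr)
    ((blocks3 hp).injective.comp Sum.inr_injective)
  have hmono : ∀ i j : Fin s, i ≤ j →
      l (blocks3 hk (.inr (.inl j))) ≤ l (blocks3 hk (.inr (.inl i))) := fun i j hij =>
    hl (by rw [Fin.le_def, blocks3_inr_inl, blocks3_inr_inl]; simpa using hij)
  refine ⟨r, s, t, u, v, hk, hm, hp, U, V, W, fun i => √(l (blocks3 hk (.inr (.inl i)))),
    fun i => √(1 - l (blocks3 hk (.inr (.inl i)))), hU, hV, hW, ?_, ?_, ?_, ?_, ?_, ?_⟩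
  · exact fun i j hij => Real.sqrt_le_sqrt (hmono i j hij)
  · exact fun i j hij => Real.sqrt_le_sqrt (sub_le_sub_left (hmono i j hij) 1)
  · exact fun i => ⟨Real.sqrt_pos.2 (e2 i), by
      rw [Real.sqrt_lt' one_pos]; simpa using e2' i⟩
  · exact fun i => ⟨Real.sqrt_pos.2 (sub_pos.2 (e2' i)), by
      rw [Real.sqrt_lt' one_pos]; simpa using e2 i⟩
  · ext a (j | j | j)
    · have := hU' a (.inl j)
      simp only [Function.comp_apply, Sum.map_inl, id, e1, Real.sqrt_one, mul_one] at this
      simpa [mul_apply, sigmaB, one_apply] using this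
    · have := hU' a (.inr j)
      simp only [Function.comp_apply, Sum.map_inr] at this
      simpa [mul_apply, sigmaB, diagonal_apply] using this
    · have := column_eq_zero h₁ (e3 j) a
      simpa [mul_apply, sigmaB] using this
  · ext a (j | j | j)
    · have := column_eq_zero h₂ (j := blocks3 hk (.inl j)) (by simp [e1]) a
      simpa [mul_apply, sigmaC] using this
    · have := hV' a (.inl j)
      simp only [Function.comp_apply] at this
      simpa [mul_apply, sigmaC, diagonal_apply] using this
    · have := hV' a (.inr j)
      simp only [Function.comp_apply, e3, sub_zero, Real.sqrt_one, mul_one] at this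
      simpa [mul_apply, sigmaC, one_apply] using this

/-! ### Existence of the GSVD. -/

/-- Up to reindexing, D Q = [P diag(w), 0] and P = U S Wᵀ. Shared by the equations for B and Cᵀ. -/
lemma submatrix_eq_mul_fromCols {r s t d n q : ℕ} (h : r + (s + t) + d = n) {ι : Type*} [Fintype ι]
    [DecidableEq ι] (D : Matrix (Fin q) (Fin n) ℝ) (Q : Matrix (Fin n) (Fin n) ℝ)
    (P : Matrix (Fin q) (Fin (r + (s + t))) ℝ)
    {W : Matrix (Fin (r + (s + t))) (Fin (r + (s + t))) ℝ}
    (hW : W ∈ orthogonalGroup (Fin (r + (s + t))) ℝ)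
    {U : Matrix (Fin q) (Fin q) ℝ} (hU : U ∈ orthogonalGroup (Fin q) ℝ) (e : ι ≃ Fin q)
    (S : Matrix ι (Fin r ⊕ (Fin s ⊕ Fin t)) ℝ) (w : Fin r ⊕ (Fin s ⊕ Fin t) → ℝ)
    (h₁ : ∀ a j, (D * Q : Matrix (Fin q) (Fin n) ℝ) a (blocks4 h (.inl j)) =
      P a (blocks3 rfl j) * w j)
    (h₂ : ∀ a j, (D * Q : Matrix (Fin q) (Fin n) ℝ) a (blocks4 h (.inr j)) = 0)
    (hS : (P * W).submatrix id (blocks3 rfl) = U.submatrix id e * S) :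
    (Uᵀ * D * Q).submatrix e (blocks4 h) =
      S * fromCols ((W.submatrix (blocks3 rfl) (blocks3 rfl))ᵀ * diagonal w) 0 := by
  have hP : P.submatrix id (blocks3 rfl) =
      U.submatrix id e * S * (W.submatrix (blocks3 rfl) (blocks3 rfl))ᵀ := by
    rw [← hS, transpose_submatrix, submatrix_mul_equiv, Matrix.mul_assoc,
      mul_transpose_of_mem_orthogonalGroup hW, Matrix.mul_one]
  have hUU : Uᵀ.submatrix e id * U.submatrix id e = 1 := by
    rw [← submatrix_mul _ _ _ _ _ Function.bijective_id, transpose_mul_of_mem_orthogonalGroup hU,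
      submatrix_one_equiv]
  have hDQ : (D * Q).submatrix id (blocks4 h) =
      fromCols (P.submatrix id (blocks3 rfl) * diagonal w) 0 := by
    ext a (j | j)
    · simpa [mul_diagonal] using h₁ a j
    · simpa using h₂ a j
  rw [Matrix.mul_assoc, submatrix_mul _ _ _ id _ Function.bijective_id, hDQ, hP, mul_fromCols,
    mul_fromCols, Matrix.mul_zero, Matrix.mul_zero]
  congr 1
  rw [Matrix.mul_assoc, Matrix.mul_assoc, ← Matrix.mul_assoc _ _ (S * _), hUU, Matrix.one_mul]

lemma nonempty_GSVD {m n p : ℕ} (B : Matrix (Fin m) (Fin n) ℝ) (C : Matrix (Fin n) (Fin p) ℝ) :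
    Nonempty (GSVD B C) := by
  obtain ⟨K, hK⟩ : ∃ K, K = fromRows B Cᵀ := ⟨_, rfl⟩
  obtain ⟨Q, hQ, l, hl, hKQ⟩ := exists_orthogonal_diagonal (S := Kᵀ * K)
    (by rw [transpose_mul, transpose_transpose])
  have hQQ := transpose_mul_of_mem_orthogonalGroup hQ
  have hQQ' := mul_transpose_of_mem_orthogonalGroup hQ
  have hZ : (K * Q)ᵀ * (K * Q) = diagonal l := by
    rw [transpose_mul, Matrix.mul_assoc, ← Matrix.mul_assoc _ K, hKQ, ← Matrix.mul_assoc, hQQ,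
      Matrix.one_mul]
  have hKK : Kᵀ * K = Q * (diagonal l * Qᵀ) := by
    rw [← Matrix.mul_assoc, ← hKQ, Matrix.mul_assoc, hQQ', Matrix.mul_one]
  have hZ' : ∀ i j, ∑ a, (B * Q : Matrix (Fin m) (Fin n) ℝ) a i * (B * Q : Matrix _ _ ℝ) a j +
      ∑ a, (Cᵀ * Q : Matrix (Fin p) (Fin n) ℝ) a i * (Cᵀ * Q : Matrix _ _ ℝ) a j =
      diagonal l i j := by
    intro i j
    rw [← hZ, hK, fromRows_mul, mul_apply, Fintype.sum_sum_type]
    rfl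
  have hl0 : ∀ i, 0 ≤ l i := by
    intro i
    rw [← diagonal_apply_eq l i, ← hZ']
    exact add_nonneg (Finset.sum_nonneg fun a _ => mul_self_nonneg _)
      (Finset.sum_nonneg fun a _ => mul_self_nonneg _)
  have hchar : (Kᵀ * K).charpoly = ∏ i, (Polynomial.X - Polynomial.C (l i)) := by
    rw [hKK, charpoly_mul_comm, Matrix.mul_assoc, hQQ, Matrix.mul_one, charpoly_diagonal]
  obtain ⟨k, hkn, hk⟩ := exists_threshold (P := fun i => 0 < l i)
    fun i j hij hj => hj.trans_le (hl hij)
  have hlz : ∀ i : Fin n, k ≤ (i : ℕ) → l i = 0 := fun i hi =>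
    le_antisymm (not_lt.1 fun h => absurd ((hk i).1 h) (not_lt.2 hi)) (hl0 i)
  have hrank : K.rank = k := by
    have hdet : IsUnit Q.det := isUnit_det_of_left_inverse hQQ
    rw [← rank_transpose_mul_self, ← rank_mul_eq_left_of_isUnit_det Q _ hdet, hKQ,
      rank_mul_eq_right_of_isUnit_det Q _ hdet, rank_diagonal]
    have : ∀ i : Fin n, l i ≠ 0 ↔ (i : ℕ) < k := fun i => by
      rw [← hk, (hl0 i).lt_iff_ne, ne_comm]
    simp only [this]
    rw [Fintype.card_subtype, Fin.card_filter_val_lt, min_eq_right hkn]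
  have hpos : ∀ x : Fin k, 0 < l (Fin.castLE hkn x) := fun x => (hk _).2 x.2
  obtain ⟨P₁, hP₁⟩ : ∃ P : Matrix (Fin m) (Fin k) ℝ, P = of fun a x =>
    (B * Q : Matrix (Fin m) (Fin n) ℝ) a (Fin.castLE hkn x) / √(l (Fin.castLE hkn x)) := ⟨_, rfl⟩
  obtain ⟨P₂, hP₂⟩ : ∃ P : Matrix (Fin p) (Fin k) ℝ, P = of fun a x =>
    (Cᵀ * Q : Matrix (Fin p) (Fin n) ℝ) a (Fin.castLE hkn x) / √(l (Fin.castLE hkn x)) := ⟨_, rfl⟩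
  -- The sum is the Gram matrix of the first k columns of K Q, each scaled to unit length.
  have hP : P₁ᵀ * P₁ + P₂ᵀ * P₂ = 1 := by
    ext x y
    rw [Matrix.add_apply, mul_apply, mul_apply]
    simp only [transpose_apply, hP₁, hP₂, of_apply, div_mul_div_comm]
    rw [← Finset.sum_div, ← Finset.sum_div, ← add_div, hZ', diagonal_apply, one_apply]
    simp only [(Fin.castLE_injective hkn).eq_iff]
    split_ifs with hxy
    · rw [hxy, Real.mul_self_sqrt (hl0 _), div_self (hpos y).ne']
    · rw [zero_div]
  obtain ⟨r, s, t, u, v, rfl, hm, hp, U, V, W, β, γ, hU, hV, hW, hβ, hγ, hβ', hγ', hB, hC⟩ :=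
    exists_cs_decomposition P₁ P₂ hP
  obtain ⟨d, hn⟩ := Nat.exists_eq_add_of_le hkn
  have hcast : ∀ j, blocks4 hn.symm (.inl j) = Fin.castLE hkn (blocks3 rfl j) := fun j =>
    Fin.ext (blocks4_inl hn.symm j)
  have hinr : ∀ j, l (blocks4 hn.symm (.inr j)) = 0 := fun j =>
    hlz _ (by rw [blocks4_inr]; omega)
  let w : Fin r ⊕ (Fin s ⊕ Fin t) → ℝ := fun i => √(l (Fin.castLE hkn (blocks3 rfl i)))
  have hw : ∀ i, 0 < w i := fun i => Real.sqrt_pos.2 (hpos _)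
  have hcol : ∀ a j, (K * Q : Matrix _ _ ℝ) a (blocks4 hn.symm (.inr j)) = 0 := fun a j =>
    column_eq_zero hZ (hinr j) a
  rw [hK, fromRows_mul] at hcol
  refine ⟨{ r, s, t, u, v, d, U, V, Q, β, γ,
            W := W.submatrix (blocks3 rfl) (blocks3 rfl)
            R := diagonal w
            rank_eq := by rw [← hK, hrank]
            m_eq := hm
            p_eq := hp
            n_eq := hn.symm
            U_orth := hU
            V_orth := hV
            W_orth := ?_
            Q_orth := hQ
            R_nonsingular := ?_
            R_singularValues := ?_
            β_antitone := hβ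
            γ_monotone := hγ
            β_mem := hβ'
            γ_mem := hγ'
            B_eq := ?_
            C_eq := ?_ }⟩
  · rw [mem_orthogonalGroup_iff, transpose_submatrix, submatrix_mul_equiv,
      mul_transpose_of_mem_orthogonalGroup hW, submatrix_one_equiv]
  · rw [det_diagonal, isUnit_iff_ne_zero]
    exact (Finset.prod_pos fun i _ => hw i).ne'
  · have hR : ((diagonal w)ᵀ * diagonal w).charpoly =
        ∏ i, (Polynomial.X - Polynomial.C (l (Fin.castLE hkn i))) := by
      rw [diagonal_transpose, diagonal_mul_diagonal, charpoly_diagonal,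
        ← (blocks3 (rfl : r + (s + t) = _)).prod_comp]
      exact Finset.prod_congr rfl fun i _ => by rw [Real.mul_self_sqrt (hl0 _)]
    ext j
    rw [matSingularValues_of_charpoly _ _ (hl.comp_monotone (Fin.strictMono_castLE hkn).monotone)
      hR, ← hK, matSingularValues_of_charpoly K l hl hchar]
    split_ifs with h₁ h₂ h₂
    · rfl
    · omega
    -- At indices from k to n - 1 the zero eigenvalues of Kᵀ K match the zero tail of the singular
    -- values of R.
    · rw [hlz _ (not_lt.1 h₁), Real.sqrt_zero]
    · rfl
  · refine submatrix_eq_mul_fromCols hn.symm B Q P₁ hW hU (blocks3 hm) _ w ?_ ?_ hB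
    · intro a j
      rw [hcast, hP₁, of_apply, div_mul_cancel₀ _ (hw j).ne']
    · exact fun a j => hcol (.inl a) j
  · refine submatrix_eq_mul_fromCols hn.symm Cᵀ Q P₂ hW hV (blocks3 hp) _ w ?_ ?_ hC
    · intro a j
      rw [hcast, hP₂, of_apply, div_mul_cancel₀ _ (hw j).ne']
    · exact fun a j => hcol (.inr a) j

theorem mainTheorem6 {m n p : ℕ} (A : Matrix (Fin m) (Fin p) ℝ) (B : Matrix (Fin m) (Fin n) ℝ)
    (C : Matrix (Fin n) (Fin p) ℝ) :
    Nonempty (GSVD B C) ∧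
    ∀ G : GSVD B C,
      ((G.symmSol A)ᵀ = G.symmSol A ∧
        ∀ X : Matrix (Fin n) (Fin n) ℝ, Xᵀ = X →
          ‖A - B * G.symmSol A * C‖ ≤ ‖A - B * X * C‖) ∧
      ((G.skewSol A)ᵀ = -G.skewSol A ∧
        ∀ X : Matrix (Fin n) (Fin n) ℝ, Xᵀ = -X →
          ‖A - B * G.skewSol A * C‖ ≤ ‖A - B * X * C‖) :=
  ⟨nonempty_GSVD B C, fun G =>
    ⟨⟨G.transpose_symmSol A, fun _ hX => G.norm_symmSol_le A hX⟩,
      ⟨G.transpose_skewSol A, fun _ hX => G.norm_skewSol_le A hX⟩⟩⟩
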